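/- Let $n,q\ge 1$ and $k\ge 0$ be integers, let $0<\epsilon<1$ and $0<\delta<1$, and let $A\in\mathbb{R}^{n\times n}$ be an arbitrary matrix. Let $S\in\mathbb{R}^{n\times q}$ be a random matrix whose entries $S_{ij}$ are independent and distributed as $\mathcal N(0,1)/\sqrt q$. If $$q\ \ge\ 1152\,e\,\frac{9^{k}}{\epsilon^{2}\delta},$$ then, with probability at least $1-\delta$, the matrix $AS$ is an $(\epsilon,0,k)$-projection-cost-preserving sketch (PCPS) of $A$; that is, with probability at least $1-\delta$, simultaneously for all orthogonal projection matrices $P\in\mathbb{R}^{n\times n}$ of rank $k$, $$(1-\epsilon)\,\|A-PA\|_F^2\ \le\ \|AS-PAS\|_F^2\ \le\ (1+\epsilon)\,\|A-PA\|_F^2 .$$ Here, for matrices $A\in\mathbb{R}^{n\times d}$ and $\tilde A\in\mathbb{R}^{n\times d'}$, an error $0\le\epsilon<1$ and a constant $c\ge 0$, $\tilde A$ is called an $(\epsilon,c,k)$-PCPS of $A$ if $(1-\epsilon)\|A-PA\|_F^2\le\|\tilde A-P\tilde A\|_F^2+c\le(1+\epsilon)\|A-PA\|_F^2$ for all rank-$k$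 orthogonal projection matrices $P\in\mathbb{R}^{n\times n}$, where $\|\cdot\|_F$ is the Frobenius norm. -/

import Mathlib

open MeasureTheory ProbabilityTheory
open scoped Matrix Matrix.Norms.Frobenius

/-- `B` is an `(ε, c, k)`-projection-cost-preserving sketch of `A`: the error satisfies `0 ≤ ε < 1`,
the constant satisfies `0 ≤ c`, and for every orthogonal projection matrix `P` of rank `k`
`(1 - ε) ‖A - P A‖_F ^ 2 ≤ ‖B - P B‖_F ^ 2 + c ≤ (1 + ε) ‖A - P A‖_F ^ 2`.
The norm is the Frobenius norm. -/
def IsPCPS {n d d' : ℕ} (ε c : ℝ) (k : ℕ)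
    (A : Matrix (Fin n) (Fin d) ℝ) (B : Matrix (Fin n) (Fin d') ℝ) : Prop :=
  0 ≤ ε ∧ ε < 1 ∧ 0 ≤ c ∧
    ∀ P : Matrix (Fin n) (Fin n) ℝ, IsStarProjection P → P.rank = k →
      (1 - ε) * ‖A - P * A‖ ^ 2 ≤ ‖B - P * B‖ ^ 2 + c ∧
        ‖B - P * B‖ ^ 2 + c ≤ (1 + ε) * ‖A - P * A‖ ^ 2

/-- `S` is a random `n × q` matrix with independent entries, each distributed as `N(0,1) / √q`. -/
def IsScaledGaussianMatrix {Ω : Type*} [MeasurableSpace Ω] (μ : Measure Ω) {n q : ℕ}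
    (S : Ω → Matrix (Fin n) (Fin q) ℝ) : Prop :=
  (∀ i j, HasLaw (fun ω => S ω i j) ((gaussianReal 0 1).map (fun x => x / √(q : ℝ))) μ) ∧
    iIndepFun (fun (p : Fin n × Fin q) ω => S ω p.1 p.2) μ

/-! With `G = S Sᵀ - 1` and `B = A - P A`, the sketching error is exactly `tr(B G Bᵀ)`, so the
difficulty is uniformity in `P`. No net or union bound is used. Instead one fixes, independently of
`P`, a projection `Q` on the right minimizing `r = ‖A - A Q‖` under `‖Q‖² ≤ k`, and writes `A - A Q
= r R` with `‖R‖ ≤ 1`. Every rank-`k` cost satisfies `r ≤ ‖B‖`, and `B = B Q + r (1 - P) R`.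
Expanding `tr(B G Bᵀ)` along this splitting gives (`Matrix.abs_trace_mul_mul_transpose_le`) the
bound `‖B‖²` times a quantity made of `Q G Qᵀ`, `Q G Rᵀ` and `R G Rᵀ`, in which `P` no longer
appears.

That quantity is controlled by second moments: `E‖X G Yᵀ‖² ≤ (2/q) ‖X‖² ‖Y‖²` and `E tr(X G Xᵀ)² ≤
(2/q) ‖X‖⁴`, both consequences of Isserlis' formula. Markov's inequality then needs only `q` of
order `k² / (ε² δ)`, far below the assumed size. -/

theorem integral_pow_four_gaussianReal : ∫ x, x ^ 4 ∂(gaussianReal 0 1) = 3 := by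
  have h : iteratedDeriv 4 (mgf id (gaussianReal 0 1)) 0 = ∫ x, x ^ 4 ∂(gaussianReal 0 1) := by
    rw [iteratedDeriv_mgf_zero] <;> simp
  rw [← h, mgf_id_gaussianReal]
  -- Polynomials of degree at most 4 times `exp (t²/2)`: the derivative stays in this family as long
  -- as `e = 0`, which suffices for four differentiations of the moment generating function.
  have step : ∀ (a b c d e : ℝ), deriv (fun t : ℝ =>
      (a + b * t + c * t ^ 2 + d * t ^ 3 + e * t ^ 4) * Real.exp (t ^ 2 / 2)) = fun t : ℝ =>
      (b + (2 * c + a) * t + (3 * d + b) * t ^ 2 + (4 * e + c) * t ^ 3 + (d + e * t) * t ^ 4)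
        * Real.exp (t ^ 2 / 2) := by
    intro a b c d e
    funext t
    have h1 : HasDerivAt (fun t : ℝ => a + b * t + c * t ^ 2 + d * t ^ 3 + e * t ^ 4)
        (b * 1 + c * (2 * t) + d * (3 * t ^ 2) + e * (4 * t ^ 3)) t := by
      have h2 := hasDerivAt_pow 2 t
      have h3 := hasDerivAt_pow 3 t
      have h4 := hasDerivAt_pow 4 t
      norm_num at h2 h3 h4
      exact ((((hasDerivAt_id' t).const_mul b).const_add a).add (h2.const_mul c)).add
        (h3.const_mul d) |>.add (h4.const_mul e)
    have h5 : HasDerivAt (fun t : ℝ => Real.exp (t ^ 2 / 2)) (Real.exp (t ^ 2 / 2) * t) t := by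
      have h2 := ((hasDerivAt_pow 2 t).div_const 2).exp
      convert h2 using 1
      norm_num
    exact (h1.mul h5).deriv.trans (by ring)
  have e0 : (fun t : ℝ => Real.exp ((0 : ℝ) * t + ((1 : NNReal) : ℝ) * t ^ 2 / 2)) = fun t =>
      (1 + 0 * t + 0 * t ^ 2 + 0 * t ^ 3 + 0 * t ^ 4) * Real.exp (t ^ 2 / 2) := by
    funext t; simp
  have e1 : deriv (fun t : ℝ => Real.exp ((0 : ℝ) * t + ((1 : NNReal) : ℝ) * t ^ 2 / 2)) = fun t =>
      (0 + 1 * t + 0 * t ^ 2 + 0 * t ^ 3 + 0 * t ^ 4) * Real.exp (t ^ 2 / 2) := by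
    rw [e0, step]; funext t; ring
  have e2 : deriv (fun t : ℝ => (0 + 1 * t + 0 * t ^ 2 + 0 * t ^ 3 + 0 * t ^ 4) *
      Real.exp (t ^ 2 / 2)) = fun t =>
      (1 + 0 * t + 1 * t ^ 2 + 0 * t ^ 3 + 0 * t ^ 4) * Real.exp (t ^ 2 / 2) := by
    rw [step]; funext t; ring
  have e3 : deriv (fun t : ℝ => (1 + 0 * t + 1 * t ^ 2 + 0 * t ^ 3 + 0 * t ^ 4) *
      Real.exp (t ^ 2 / 2)) = fun t =>
      (0 + 3 * t + 0 * t ^ 2 + 1 * t ^ 3 + 0 * t ^ 4) * Real.exp (t ^ 2 / 2) := by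
    rw [step]; funext t; ring
  rw [iteratedDeriv_succ', iteratedDeriv_succ', iteratedDeriv_succ', iteratedDeriv_one, e1, e2, e3,
    step]
  norm_num

/-! ### Moments of independent standard Gaussians. -/

section StandardGaussianFamily

variable {Ω ι : Type*} [MeasurableSpace Ω] {μ : Measure Ω}

theorem ProbabilityTheory.HasLaw.integral_eq_zero_of_gaussianReal {X : Ω → ℝ}
    (hX : HasLaw X (gaussianReal 0 1) μ) : ∫ ω, X ω ∂μ = 0 := by
  have := hX.integral_comp (f := fun x : ℝ => x) (by fun_prop)
  simpa [Function.comp_def, integral_id_gaussianReal] using this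

theorem ProbabilityTheory.HasLaw.integral_sq_eq_one_of_gaussianReal {X : Ω → ℝ}
    (hX : HasLaw X (gaussianReal 0 1) μ) : ∫ ω, X ω ^ 2 ∂μ = 1 := by
  have h := hX.integral_comp (f := fun x : ℝ => x ^ 2) (by fun_prop)
  have h2 := variance_fun_id_gaussianReal (μ := 0) (v := 1)
  rw [variance_of_integral_eq_zero (by fun_prop) (by simp)] at h2
  simpa [Function.comp_def] using h.trans h2

theorem ProbabilityTheory.HasLaw.integral_pow_four_eq_three_of_gaussianReal {X : Ω → ℝ}
    (hX : HasLaw X (gaussianReal 0 1) μ) : ∫ ω, X ω ^ 4 ∂μ = 3 := by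
  have h := hX.integral_comp (f := fun x : ℝ => x ^ 4) (by fun_prop)
  simpa [Function.comp_def] using h.trans integral_pow_four_gaussianReal

theorem ProbabilityTheory.HasLaw.memLp_of_gaussianReal {X : Ω → ℝ}
    (hX : HasLaw X (gaussianReal 0 1) μ) (p : NNReal) : MemLp X p μ := by
  have h := memLp_id_gaussianReal (μ := 0) (v := 1) p
  rw [← hX.map_eq, memLp_map_measure_iff (by fun_prop) hX.aemeasurable] at h
  exact h

theorem integrable_mul_mul_mul_of_memLp_four {f₁ f₂ f₃ f₄ : Ω → ℝ} (h₁ : MemLp f₁ 4 μ)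
    (h₂ : MemLp f₂ 4 μ) (h₃ : MemLp f₃ 4 μ) (h₄ : MemLp f₄ 4 μ) :
    Integrable (fun ω => f₁ ω * f₂ ω * f₃ ω * f₄ ω) μ := by
  have pow4 : ∀ {f : Ω → ℝ}, MemLp f 4 μ → Integrable (fun ω => f ω ^ 4) μ := by
    intro f hf
    have := hf.integrable_norm_pow (p := 4) (by norm_num)
    refine this.congr (Filter.Eventually.of_forall fun ω => ?_)
    simp only [Real.norm_eq_abs]
    exact Even.pow_abs (by decide) _
  refine (((pow4 h₁).add (pow4 h₂)).add ((pow4 h₃).add (pow4 h₄))).mono'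
    (((h₁.1.mul h₂.1).mul h₃.1).mul h₄.1) (Filter.Eventually.of_forall fun ω => ?_)
  simp only [Pi.add_apply, Real.norm_eq_abs]
  generalize f₁ ω = a
  generalize f₂ ω = b
  generalize f₃ ω = c
  generalize f₄ ω = d
  rw [abs_le]
  constructor <;>
  -- AM-GM: the product is dominated by the sum of the fourth powers.
  nlinarith [sq_nonneg (a * b + c * d), sq_nonneg (a * b - c * d), sq_nonneg (a ^ 2 - b ^ 2),
    sq_nonneg (c ^ 2 - d ^ 2), sq_nonneg (a ^ 2), sq_nonneg (b ^ 2), sq_nonneg (c ^ 2),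
    sq_nonneg (d ^ 2)]

variable {g : ι → Ω → ℝ}

theorem integral_mul_of_forall_hasLaw_gaussianReal [DecidableEq ι]
    (hg : ∀ i, HasLaw (g i) (gaussianReal 0 1) μ) (hind : iIndepFun g μ) (a b : ι) :
    ∫ ω, g a ω * g b ω ∂μ = if a = b then 1 else 0 := by
  split_ifs with h
  · subst h
    simpa [sq] using (hg a).integral_sq_eq_one_of_gaussianReal
  · have := (hind.indepFun h).integral_mul_eq_mul_integral
      (hg a).aemeasurable.aestronglyMeasurable (hg b).aemeasurable.aestronglyMeasurable
    simpa [(hg a).integral_eq_zero_of_gaussianReal] using this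

theorem integral_mul_mul_mul_eq_zero_of_ne
    (hg : ∀ i, HasLaw (g i) (gaussianReal 0 1) μ) (hind : iIndepFun g μ) {a b c d : ι}
    (hb : a ≠ b) (hc : a ≠ c) (hd : a ≠ d) :
    ∫ ω, g a ω * (g b ω * g c ω * g d ω) ∂μ = 0 := by
  classical
  have h := hind.indepFun_finset₀ {a} {b, c, d} (by simp [hb, hc, hd])
    (fun i => (hg i).aemeasurable)
  have hp := fun i => measurable_pi_apply (X := fun _ : ({b, c, d} : Finset ι) => ℝ) i
  have ha := measurable_pi_apply (X := fun _ : ({a} : Finset ι) => ℝ) ⟨a, by simp⟩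
  have h2 := h.comp (φ := fun x : (({a} : Finset ι) → ℝ) => x ⟨a, by simp⟩)
    (ψ := fun x : (({b, c, d} : Finset ι) → ℝ) =>
      x ⟨b, by simp⟩ * x ⟨c, by simp⟩ * x ⟨d, by simp⟩) ha
    (((hp ⟨b, by simp⟩).mul (hp ⟨c, by simp⟩)).mul (hp ⟨d, by simp⟩))
  have hm := fun i => (hg i).aemeasurable.aestronglyMeasurable
  have := h2.integral_mul_eq_mul_integral (hm a) (((hm b).mul (hm c)).mul (hm d))
  simpa [Function.comp_def, (hg a).integral_eq_zero_of_gaussianReal] using this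

theorem integral_sq_mul_sq_of_ne
    (hg : ∀ i, HasLaw (g i) (gaussianReal 0 1) μ) (hind : iIndepFun g μ) {a b : ι}
    (hb : a ≠ b) : ∫ ω, g a ω ^ 2 * g b ω ^ 2 ∂μ = 1 := by
  have h2 := (hind.indepFun hb).comp (φ := fun x : ℝ => x ^ 2) (ψ := fun x : ℝ => x ^ 2)
    (by fun_prop) (by fun_prop)
  have hm := fun i => (hg i).aemeasurable.aestronglyMeasurable
  have := h2.integral_mul_eq_mul_integral ((hm a).pow 2) ((hm b).pow 2)
  simpa [Function.comp_def, (hg _).integral_sq_eq_one_of_gaussianReal] using this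

/-- Isserlis' formula for four members of a family of independent standard Gaussians. -/
theorem integral_mul_mul_mul_of_forall_hasLaw_gaussianReal [DecidableEq ι]
    (hg : ∀ i, HasLaw (g i) (gaussianReal 0 1) μ) (hind : iIndepFun g μ) (a b c d : ι) :
    ∫ ω, g a ω * g b ω * g c ω * g d ω ∂μ =
      (if a = b then 1 else 0) * (if c = d then 1 else 0) +
      (if a = c then 1 else 0) * (if b = d then 1 else 0) +
      (if a = d then 1 else 0) * (if b = c then 1 else 0) := by
  have hz := fun {a b c d : ι} => integral_mul_mul_mul_eq_zero_of_ne hg hind (a := a) (b := b)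
    (c := c) (d := d)
  have hs := fun {a b : ι} => integral_sq_mul_sq_of_ne hg hind (a := a) (b := b)
  have hf := (hg a).integral_pow_four_eq_three_of_gaussianReal
  by_cases hab : a = b
  · subst hab
    by_cases hcd : c = d
    · subst hcd
      by_cases hac : a = c
      · subst hac
        simp only [if_true]
        norm_num
        rw [← hf]
        congr 1; funext ω; ring
      · simp only [hac, if_true, if_false]
        norm_num
        rw [← hs hac]
        congr 1; funext ω; ring
    · by_cases hac : a = c
      · subst hac
        simp only [hcd, if_true, if_false]
        norm_num
        rw [← hz (Ne.symm hcd) (Ne.symm hcd) (Ne.symm hcd)]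
        congr 1; funext ω; ring
      · simp only [hcd, hac, if_true, if_false]
        norm_num
        rw [← hz (Ne.symm hac) (Ne.symm hac) hcd]
        congr 1; funext ω; ring
  · by_cases hac : a = c
    · subst hac
      by_cases hbd : b = d
      · subst hbd
        simp only [hab, Ne.symm hab, if_true, if_false]
        norm_num
        rw [← hs hab]
        congr 1; funext ω; ring
      · simp only [hab, Ne.symm hab, hbd, if_true, if_false]
        norm_num
        rw [← hz (Ne.symm hab) (Ne.symm hab) hbd]
        congr 1; funext ω; ring
    · by_cases had : a = d
      · subst had
        by_cases hbc : b = c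
        · subst hbc
          simp only [hab, if_true, if_false]
          norm_num
          rw [← hs hab]
          congr 1; funext ω; ring
        · simp only [hab, hac, hbc, if_true, if_false]
          norm_num
          rw [← hz (Ne.symm hab) hbc (Ne.symm hab)]
          congr 1; funext ω; ring
      · simp only [hab, hac, had, if_false]
        norm_num
        rw [← hz hab hac had]
        congr 1; funext ω; ring

end StandardGaussianFamily

theorem Matrix.frobenius_norm_sq {m n : Type*} [Fintype m] [Fintype n] (A : Matrix m n ℝ) :
    ‖A‖ ^ 2 = ∑ i, ∑ j, A i j ^ 2 := by
  rw [Matrix.frobenius_norm_def, ← Real.sqrt_eq_rpow, Real.sq_sqrt (by positivity)]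
  simp

theorem Matrix.frobenius_norm_sq_eq_trace {m n : Type*} [Fintype m] [Fintype n]
    (A : Matrix m n ℝ) : ‖A‖ ^ 2 = (A * Aᵀ).trace := by
  rw [Matrix.frobenius_norm_sq]
  simp [Matrix.trace, Matrix.mul_apply, sq]

/-! ### Second moment of a centered Gaussian quadratic form. -/

section QuadraticForm

variable {Ω ι : Type*} [MeasurableSpace Ω] {μ : Measure Ω} {g : ι → Ω → ℝ} [DecidableEq ι]

theorem integrable_mul_sub_mul_mul_sub
    (hg : ∀ i, HasLaw (g i) (gaussianReal 0 1) μ) [IsProbabilityMeasure μ] (a b c d : ι) :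
    Integrable (fun ω => (g a ω * g b ω - if a = b then 1 else 0) *
      (g c ω * g d ω - if c = d then 1 else 0)) μ := by
  have h4 := fun i => (hg i).memLp_of_gaussianReal 4
  have hL := fun i => show MemLp (g i) 2 μ from (hg i).memLp_of_gaussianReal 2
  have h2 : ∀ i j, Integrable (fun ω => g i ω * g j ω) μ := fun i j =>
    (hL i).integrable_mul (hL j)
  have h := ((integrable_mul_mul_mul_of_memLp_four (h4 a) (h4 b) (h4 c) (h4 d)).sub
    ((h2 a b).mul_const (if c = d then 1 else 0))).sub
    (((h2 c d).const_mul (if a = b then 1 else 0)).sub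
      (integrable_const ((if a = b then 1 else 0) * (if c = d then 1 else 0))))
  refine h.congr (Filter.Eventually.of_forall fun ω => ?_)
  simp only [Pi.sub_apply]
  ring

/-- Centering cancels the Isserlis pairing `(ab)(cd)` and leaves the two mixed ones. -/
theorem integral_mul_sub_mul_mul_sub
    (hg : ∀ i, HasLaw (g i) (gaussianReal 0 1) μ) (hind : iIndepFun g μ) (a b c d : ι) :
    ∫ ω, (g a ω * g b ω - if a = b then 1 else 0) * (g c ω * g d ω - if c = d then 1 else 0) ∂μ =
      (if a = c then 1 else 0) * (if b = d then 1 else 0) +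
      (if a = d then 1 else 0) * (if b = c then 1 else 0) := by
  have := hind.isProbabilityMeasure
  have h4 := fun i => (hg i).memLp_of_gaussianReal 4
  have hL := fun i => show MemLp (g i) 2 μ from (hg i).memLp_of_gaussianReal 2
  have h2 : ∀ i j, Integrable (fun ω => g i ω * g j ω) μ := fun i j =>
    (hL i).integrable_mul (hL j)
  have e : ∀ ω, (g a ω * g b ω - if a = b then 1 else 0) *
      (g c ω * g d ω - if c = d then 1 else 0) =
      (g a ω * g b ω * g c ω * g d ω - (g a ω * g b ω) * (if c = d then 1 else 0)) -
      ((if a = b then 1 else 0) * (g c ω * g d ω) -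
        (if a = b then 1 else 0) * (if c = d then 1 else 0)) := fun ω => by ring
  have i4 := integrable_mul_mul_mul_of_memLp_four (h4 a) (h4 b) (h4 c) (h4 d)
  simp_rw [e]
  rw [integral_sub, integral_sub, integral_sub, integral_mul_const, integral_const_mul,
    integral_mul_of_forall_hasLaw_gaussianReal hg hind,
    integral_mul_of_forall_hasLaw_gaussianReal hg hind,
    integral_mul_mul_mul_of_forall_hasLaw_gaussianReal hg hind, integral_const]
  · simp only [probReal_univ, one_smul]
    ring
  · exact (h2 c d).const_mul _
  · exact integrable_const _
  · exact i4
  · exact (h2 a b).mul_const _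
  · exact i4.sub ((h2 a b).mul_const _)
  · exact ((h2 c d).const_mul _).sub (integrable_const _)

variable [Fintype ι]

theorem sq_sum_mul_eq_sum_sum {κ : Type*} (s : Finset κ) (f h : κ → ℝ) :
    (∑ p ∈ s, f p * h p) ^ 2 = ∑ p ∈ s, ∑ r ∈ s, f p * f r * (h p * h r) := by
  rw [sq, Finset.sum_mul_sum]
  exact Finset.sum_congr rfl fun _ _ => Finset.sum_congr rfl fun _ _ => by ring

theorem integrable_sq_centered_quadraticForm [IsProbabilityMeasure μ]
    (hg : ∀ i, HasLaw (g i) (gaussianReal 0 1) μ) (N : ι × ι → ℝ) :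
    Integrable (fun ω =>
      (∑ p, N p * (g p.1 ω * g p.2 ω - if p.1 = p.2 then 1 else 0)) ^ 2) μ := by
  simp_rw [sq_sum_mul_eq_sum_sum]
  exact integrable_finsetSum _ fun p _ => integrable_finsetSum _ fun r _ =>
    (integrable_mul_sub_mul_mul_sub hg p.1 p.2 r.1 r.2).const_mul _

/-- The two surviving pairings select `r = p` and `r = p.swap`, so the integral is `∑ (N p ^ 2 + N p
* N p.swap)`. Since `N` need not be symmetric, the second term is bounded by AM-GM. -/
theorem integral_sq_centered_quadraticForm_le
    (hg : ∀ i, HasLaw (g i) (gaussianReal 0 1) μ) (hind : iIndepFun g μ) (N : ι × ι → ℝ) :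
    ∫ ω, (∑ p, N p * (g p.1 ω * g p.2 ω - if p.1 = p.2 then 1 else 0)) ^ 2 ∂μ ≤
      2 * ∑ p, N p ^ 2 := by
  have := hind.isProbabilityMeasure
  have hi := fun p r : ι × ι =>
    (integrable_mul_sub_mul_mul_sub hg p.1 p.2 r.1 r.2).const_mul (N p * N r)
  have e : ∫ ω, (∑ p, N p * (g p.1 ω * g p.2 ω - if p.1 = p.2 then 1 else 0)) ^ 2 ∂μ =
      ∑ p, (N p ^ 2 + N p * N p.swap) := by
    simp_rw [sq_sum_mul_eq_sum_sum]
    rw [integral_finsetSum _ fun p _ => integrable_finsetSum _ fun r _ => hi p r]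
    refine Finset.sum_congr rfl fun p _ => ?_
    rw [integral_finsetSum _ fun r _ => hi p r]
    simp_rw [integral_const_mul, integral_mul_sub_mul_mul_sub hg hind, mul_add,
      Finset.sum_add_distrib]
    congr 1
    · rw [Finset.sum_eq_single p]
      · simp [sq]
      · intro r _ hr
        by_cases h1 : p.1 = r.1
        · by_cases h2 : p.2 = r.2
          · exact absurd (Prod.ext h1 h2).symm hr
          · simp [h2]
        · simp [h1]
      · simp
    · rw [Finset.sum_eq_single p.swap]
      · simp
      · intro r _ hr
        by_cases h1 : p.1 = r.2
        · by_cases h2 : p.2 = r.1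
          · exact absurd (Prod.ext h2.symm h1.symm) hr
          · simp [h2]
        · simp [h1]
      · simp
  rw [e]
  have hswap : ∑ p : ι × ι, N p.swap ^ 2 = ∑ p, N p ^ 2 :=
    Equiv.sum_comp (Equiv.prodComm ι ι) fun p => N p ^ 2
  calc ∑ p, (N p ^ 2 + N p * N p.swap)
      ≤ ∑ p, (N p ^ 2 + (N p ^ 2 / 2 + N p.swap ^ 2 / 2)) :=
        Finset.sum_le_sum fun p _ => by nlinarith [sq_nonneg (N p - N p.swap)]
    _ = 2 * ∑ p, N p ^ 2 := by
        rw [Finset.sum_add_distrib, Finset.sum_add_distrib, ← Finset.sum_div, ← Finset.sum_div,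
          hswap]
        ring

end QuadraticForm

/-! ### Second moments of the Gram error `S Sᵀ - 1`. -/

section ScaledGaussianMatrix

variable {Ω : Type*} [MeasurableSpace Ω] {μ : Measure Ω} {n q : ℕ}
  {S : Ω → Matrix (Fin n) (Fin q) ℝ}

theorem IsScaledGaussianMatrix.hasLaw_sqrt_mul (hS : IsScaledGaussianMatrix μ S) (hq : 0 < q)
    (p : Fin n × Fin q) : HasLaw (fun ω => √(q : ℝ) * S ω p.1 p.2) (gaussianReal 0 1) μ := by
  have hq' : √(q : ℝ) ≠ 0 := (Real.sqrt_pos.2 (by exact_mod_cast hq)).ne'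
  have h := hS.1 p.1 p.2
  refine ⟨h.aemeasurable.const_mul _, ?_⟩
  have e : (fun ω => √(q : ℝ) * S ω p.1 p.2) = (fun x => √(q : ℝ) * x) ∘ fun ω => S ω p.1 p.2 := rfl
  rw [e, ← AEMeasurable.map_map_of_aemeasurable (by fun_prop) h.aemeasurable, h.map_eq,
    Measure.map_map (by fun_prop) (by fun_prop)]
  convert Measure.map_id
  funext x
  simp only [Function.comp_apply, id]
  field_simp

theorem IsScaledGaussianMatrix.iIndepFun_sqrt_mul (hS : IsScaledGaussianMatrix μ S) :
    iIndepFun (fun (p : Fin n × Fin q) ω => √(q : ℝ) * S ω p.1 p.2) μ :=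
  hS.2.comp (fun _ x => √(q : ℝ) * x) fun _ => by fun_prop

/-- After rescaling to standard Gaussians, pairing with `M` becomes a centered quadratic form whose
coefficients are `q` diagonal copies of `M`, one per column. -/
theorem sum_mul_gram_sub_one_eq (hq : 0 < q) (M : Matrix (Fin n) (Fin n) ℝ)
    (T : Matrix (Fin n) (Fin q) ℝ) :
    ∑ i, ∑ j, M i j * (T * Tᵀ - 1 : Matrix (Fin n) (Fin n) ℝ) i j = (q : ℝ)⁻¹ *
      ∑ p : (Fin n × Fin q) × (Fin n × Fin q), (if p.1.2 = p.2.2 then M p.1.1 p.2.1 else 0) *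
        ((√(q : ℝ) * T p.1.1 p.1.2) * (√(q : ℝ) * T p.2.1 p.2.2) - if p.1 = p.2 then 1 else 0) := by
  have hq0 : (q : ℝ) ≠ 0 := by exact_mod_cast hq.ne'
  have hs : √(q : ℝ) * √(q : ℝ) = q := Real.mul_self_sqrt (by positivity)
  simp only [Fintype.sum_prod_type, ite_mul, zero_mul, Finset.sum_ite_eq, Finset.mem_univ, if_true]
  rw [Finset.mul_sum]
  refine Finset.sum_congr rfl fun i _ => ?_
  rw [Finset.sum_comm, Finset.mul_sum]
  refine Finset.sum_congr rfl fun j _ => ?_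
  have e : ∀ c : Fin q, M i j * (√(q : ℝ) * T i c * (√(q : ℝ) * T j c) -
      if (i, c) = (j, c) then 1 else 0) = q * M i j * (T i c * T j c) -
      M i j * if i = j then 1 else 0 := by
    intro c
    simp only [Prod.mk.injEq, and_true]
    linear_combination (M i j * T i c * T j c) * hs
  simp only [e, Finset.sum_sub_distrib, ← Finset.mul_sum, Finset.sum_const, Finset.card_univ,
    Fintype.card_fin, nsmul_eq_mul, Matrix.sub_apply, Matrix.mul_apply, Matrix.transpose_apply,
    Matrix.one_apply]
  field_simp

theorem IsScaledGaussianMatrix.integrable_sq_sum_mul [IsProbabilityMeasure μ]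
    (hS : IsScaledGaussianMatrix μ S) (hq : 0 < q) (M : Matrix (Fin n) (Fin n) ℝ) :
    Integrable (fun ω => (∑ i, ∑ j, M i j * (S ω * (S ω)ᵀ - 1 : Matrix (Fin n) (Fin n) ℝ) i j) ^ 2) μ := by
  simp_rw [sum_mul_gram_sub_one_eq hq, mul_pow]
  exact (integrable_sq_centered_quadraticForm (hS.hasLaw_sqrt_mul hq) _).const_mul _

/-- The prefactor contributes `q⁻²` and the `q` copies of `M` contribute `q`, whence the rate `2 /
q`. -/
theorem IsScaledGaussianMatrix.integral_sq_sum_mul_le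
    (hS : IsScaledGaussianMatrix μ S) (hq : 0 < q) (M : Matrix (Fin n) (Fin n) ℝ) :
    ∫ ω, (∑ i, ∑ j, M i j * (S ω * (S ω)ᵀ - 1 : Matrix (Fin n) (Fin n) ℝ) i j) ^ 2 ∂μ ≤ 2 / q * ∑ i, ∑ j, M i j ^ 2 := by
  have hq0 : (q : ℝ) ≠ 0 := by exact_mod_cast hq.ne'
  simp_rw [sum_mul_gram_sub_one_eq hq, mul_pow]
  rw [integral_const_mul]
  refine (mul_le_mul_of_nonneg_left (integral_sq_centered_quadraticForm_le
    (hS.hasLaw_sqrt_mul hq) hS.iIndepFun_sqrt_mul _) (by positivity)).trans (le_of_eq ?_)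
  simp only [Fintype.sum_prod_type, ite_pow, ne_eq, OfNat.ofNat_ne_zero, not_false_eq_true,
    zero_pow, Finset.sum_ite_eq, Finset.mem_univ, if_true]
  simp only [Finset.sum_comm (s := (Finset.univ : Finset (Fin q))), Finset.sum_const,
    Finset.card_univ, Fintype.card_fin, nsmul_eq_mul, ← Finset.mul_sum]
  field_simp

theorem mul_gram_mul_transpose_apply {a b n : Type*} [Fintype n] (X : Matrix a n ℝ)
    (Y : Matrix b n ℝ) (G : Matrix n n ℝ) (i : a) (j : b) :
    (X * G * Yᵀ) i j = ∑ s, ∑ t, Matrix.vecMulVec (X i) (Y j) s t * G s t := by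
  simp only [Matrix.mul_apply, Matrix.transpose_apply, Finset.sum_mul, Matrix.vecMulVec_apply]
  rw [Finset.sum_comm]
  exact Finset.sum_congr rfl fun _ _ => Finset.sum_congr rfl fun _ _ => by ring

variable {a b : Type*} [Fintype a] [Fintype b]

theorem IsScaledGaussianMatrix.integrable_norm_mul_mul_sq [IsProbabilityMeasure μ]
    (hS : IsScaledGaussianMatrix μ S) (hq : 0 < q) (X : Matrix a (Fin n) ℝ)
    (Y : Matrix b (Fin n) ℝ) :
    Integrable (fun ω => ‖X * (S ω * (S ω)ᵀ - 1) * Yᵀ‖ ^ 2) μ := by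
  simp_rw [Matrix.frobenius_norm_sq, mul_gram_mul_transpose_apply]
  exact integrable_finsetSum _ fun i _ => integrable_finsetSum _ fun j _ =>
    hS.integrable_sq_sum_mul hq _

/-- Each entry of the product pairs the Gram error with a rank-one matrix built from a row of `X`
and a row of `Y`; the scalar bounds add up. -/
theorem IsScaledGaussianMatrix.integral_norm_mul_mul_sq_le [IsProbabilityMeasure μ]
    (hS : IsScaledGaussianMatrix μ S) (hq : 0 < q) (X : Matrix a (Fin n) ℝ)
    (Y : Matrix b (Fin n) ℝ) :
    ∫ ω, ‖X * (S ω * (S ω)ᵀ - 1) * Yᵀ‖ ^ 2 ∂μ ≤ 2 / q * (‖X‖ ^ 2 * ‖Y‖ ^ 2) := by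
  simp_rw [Matrix.frobenius_norm_sq, mul_gram_mul_transpose_apply]
  rw [integral_finsetSum _ fun i _ => integrable_finsetSum _ fun j _ =>
    hS.integrable_sq_sum_mul hq _, Finset.sum_mul_sum, Finset.mul_sum]
  refine Finset.sum_le_sum fun i _ => ?_
  rw [integral_finsetSum _ fun j _ => hS.integrable_sq_sum_mul hq _, Finset.mul_sum]
  refine Finset.sum_le_sum fun j _ => ?_
  refine (hS.integral_sq_sum_mul_le hq _).trans (le_of_eq ?_)
  simp only [Matrix.vecMulVec_apply, mul_pow, Finset.sum_mul_sum]

theorem trace_mul_mul_transpose {a n : Type*} [Fintype n] [Fintype a] (X : Matrix a n ℝ)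
    (G : Matrix n n ℝ) : (X * G * Xᵀ).trace = ∑ s, ∑ t, (Xᵀ * X) s t * G s t := by
  have hW : ∀ s t, (Xᵀ * X) s t = (Xᵀ * X) t s := fun s t => by
    simp only [Matrix.mul_apply, Matrix.transpose_apply, mul_comm]
  rw [Matrix.trace_mul_comm, ← Matrix.mul_assoc, Matrix.trace]
  simp only [Matrix.diag_apply, Matrix.mul_apply (M := Xᵀ * X)]
  rw [Finset.sum_comm]
  exact Finset.sum_congr rfl fun s _ => Finset.sum_congr rfl fun t _ => by rw [hW]

theorem IsScaledGaussianMatrix.integrable_trace_sq [IsProbabilityMeasure μ]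
    (hS : IsScaledGaussianMatrix μ S) (hq : 0 < q) (X : Matrix a (Fin n) ℝ) :
    Integrable (fun ω => (X * (S ω * (S ω)ᵀ - 1) * Xᵀ).trace ^ 2) μ := by
  simp_rw [trace_mul_mul_transpose]
  exact hS.integrable_sq_sum_mul hq _

theorem IsScaledGaussianMatrix.integral_trace_sq_le
    (hS : IsScaledGaussianMatrix μ S) (hq : 0 < q) (X : Matrix a (Fin n) ℝ) :
    ∫ ω, (X * (S ω * (S ω)ᵀ - 1) * Xᵀ).trace ^ 2 ∂μ ≤ 2 / q * ‖X‖ ^ 4 := by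
  simp_rw [trace_mul_mul_transpose]
  refine (hS.integral_sq_sum_mul_le hq _).trans ?_
  rw [← Matrix.frobenius_norm_sq]
  have h : ‖Xᵀ * X‖ ≤ ‖X‖ * ‖X‖ := by
    simpa only [Matrix.frobenius_norm_transpose] using Matrix.frobenius_norm_mul Xᵀ X
  have h2 : ‖Xᵀ * X‖ ^ 2 ≤ ‖X‖ ^ 4 := (pow_le_pow_left₀ (norm_nonneg _) h 2).trans
    (le_of_eq (by ring))
  gcongr

end ScaledGaussianMatrix

/-! ### Projections and the deterministic error bound. -/

section Projection

variable {m n p : Type*} [Fintype m] [Fintype n] [Fintype p]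

theorem Matrix.abs_trace_mul_le (A : Matrix m n ℝ) (B : Matrix n m ℝ) :
    |(A * B).trace| ≤ ‖A‖ * ‖B‖ := by
  have e : (A * B).trace = ∑ x : m × n, A x.1 x.2 * B x.2 x.1 := by
    simp [Matrix.trace, Matrix.mul_apply, Fintype.sum_prod_type]
  have hA : ‖A‖ ^ 2 = ∑ x : m × n, A x.1 x.2 ^ 2 := by
    rw [Matrix.frobenius_norm_sq, Fintype.sum_prod_type]
  have hB : ‖B‖ ^ 2 = ∑ x : m × n, B x.2 x.1 ^ 2 := by
    rw [Matrix.frobenius_norm_sq, Fintype.sum_prod_type, Finset.sum_comm]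
  refine abs_le_of_sq_le_sq ?_ (by positivity)
  rw [mul_pow, hA, hB, e]
  exact Finset.sum_mul_sq_le_sq_mul_sq _ _ _

theorem IsStarProjection.transpose_eq {P : Matrix n n ℝ} (hP : IsStarProjection P) : Pᵀ = P := by
  have := hP.isSelfAdjoint.star_eq
  rwa [Matrix.star_eq_conjTranspose, Matrix.conjTranspose_eq_transpose_of_trivial] at this

variable [DecidableEq n]

theorem IsStarProjection.frobenius_norm_sq_eq_trace {P : Matrix n n ℝ}
    (hP : IsStarProjection P) : ‖P‖ ^ 2 = P.trace := by
  rw [Matrix.frobenius_norm_sq_eq_trace, hP.transpose_eq, hP.isIdempotentElem.eq]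

theorem IsStarProjection.frobenius_norm_mul_le {P : Matrix n n ℝ} (hP : IsStarProjection P)
    (X : Matrix n p ℝ) : ‖P * X‖ ≤ ‖X‖ := by
  have key : ∀ {R : Matrix n n ℝ}, IsStarProjection R →
      ‖R * X‖ ^ 2 = (R * (X * Xᵀ)).trace := by
    intro R hR
    rw [Matrix.frobenius_norm_sq_eq_trace, Matrix.transpose_mul, hR.transpose_eq,
      ← Matrix.mul_assoc, Matrix.trace_mul_comm, ← Matrix.mul_assoc, ← Matrix.mul_assoc,
      hR.isIdempotentElem.eq, Matrix.mul_assoc]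
  have h1 := key hP
  have h2 := key hP.one_sub
  have h3 := Matrix.frobenius_norm_sq_eq_trace X
  rw [Matrix.sub_mul 1 P (X * Xᵀ), Matrix.trace_sub, Matrix.one_mul] at h2
  refine le_of_sq_le_sq ?_ (norm_nonneg _)
  linarith [sq_nonneg ‖(1 - P) * X‖]

theorem IsStarProjection.frobenius_norm_mul_le' {P : Matrix n n ℝ} (hP : IsStarProjection P)
    (X : Matrix p n ℝ) : ‖X * P‖ ≤ ‖X‖ := by
  have h := hP.frobenius_norm_mul_le Xᵀ
  rwa [← hP.transpose_eq, ← Matrix.transpose_mul, Matrix.frobenius_norm_transpose,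
    Matrix.frobenius_norm_transpose] at h

/-- The orthogonal projection onto the row space. -/
theorem Matrix.exists_isStarProjection_mul_eq_self (M : Matrix m n ℝ) :
    ∃ Q : Matrix n n ℝ, IsStarProjection Q ∧ M * Q = M ∧ ‖Q‖ ^ 2 ≤ M.rank := by
  have hH : (Mᴴ * M).IsHermitian := Matrix.isHermitian_conjTranspose_mul_self M
  set d := hH.eigenvalues with hd
  set U : Matrix n n ℝ := (hH.eigenvectorUnitary).1 with hU
  have hUU : star U * U = 1 := Unitary.coe_star_mul_self hH.eigenvectorUnitary
  have hUU' : U * star U = 1 := Unitary.coe_mul_star_self hH.eigenvectorUnitary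
  -- Indicator of the nonzero eigenvalues of `Mᴴ * M`: conjugated by `U` it projects onto the range,
  -- and its trace counts the rank.
  set E : Matrix n n ℝ := Matrix.diagonal fun i => if d i ≠ 0 then 1 else 0 with hE
  have hEE : E * E = E := by
    rw [hE, Matrix.diagonal_mul_diagonal]
    congr 1; funext i; split_ifs <;> simp
  have hDE : Matrix.diagonal d * E = Matrix.diagonal d := by
    rw [hE, Matrix.diagonal_mul_diagonal]
    congr 1; funext i; split_ifs with h <;> simp_all
  have hEs : star E = E := by
    rw [hE, Matrix.star_eq_conjTranspose, Matrix.diagonal_conjTranspose]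
    simp
  have hspec : Mᴴ * M = U * Matrix.diagonal d * star U := by
    have := hH.spectral_theorem
    rw [Unitary.conjStarAlgAut_apply] at this
    exact this
  have hQ : IsStarProjection (U * E * star U) := by
    refine ⟨?_, ?_⟩
    · change U * E * star U * (U * E * star U) = U * E * star U
      calc U * E * star U * (U * E * star U) = U * E * (star U * U) * E * star U := by
            simp only [Matrix.mul_assoc]
        _ = U * (E * E) * star U := by rw [hUU, Matrix.mul_one, Matrix.mul_assoc U E E]
        _ = _ := by rw [hEE]
    · change star (U * E * star U) = U * E * star U
      rw [star_mul, star_mul, star_star, hEs, Matrix.mul_assoc]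
  refine ⟨U * E * star U, hQ, ?_, ?_⟩
  · have h0 : Mᴴ * M * (1 - U * E * star U) = 0 := by
      rw [Matrix.mul_sub, Matrix.mul_one, sub_eq_zero, hspec]
      calc U * Matrix.diagonal d * star U = U * (Matrix.diagonal d * E) * star U := by rw [hDE]
        _ = U * Matrix.diagonal d * (star U * U) * E * star U := by
            rw [hUU]; simp only [Matrix.mul_assoc, Matrix.mul_one]
        _ = _ := by simp only [Matrix.mul_assoc]
    rw [Matrix.conjTranspose_mul_self_mul_eq_zero, Matrix.mul_sub, Matrix.mul_one,
      sub_eq_zero] at h0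
    exact h0.symm
  · rw [hQ.frobenius_norm_sq_eq_trace, Matrix.mul_assoc, Matrix.trace_mul_comm, Matrix.mul_assoc,
      hUU, Matrix.mul_one, ← Matrix.rank_conjTranspose_mul_self, hH.rank_eq_card_non_zero_eigs,
      hE, Matrix.trace_diagonal, Finset.sum_boole, Fintype.card_subtype]

theorem IsStarProjection.frobenius_norm_sq_le_rank {P : Matrix n n ℝ} (hP : IsStarProjection P) :
    ‖P‖ ^ 2 ≤ P.rank := by
  obtain ⟨Q, -, h, hQ⟩ := P.exists_isStarProjection_mul_eq_self
  refine (pow_le_pow_left₀ (norm_nonneg _) ?_ 2).trans hQ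
  conv_lhs => rw [← h]
  exact hP.frobenius_norm_mul_le Q

/-- Compactness gives the minimizer. Stating the rank constraint as `‖Q‖ ^ 2 ≤ k` makes it visibly
closed and bounded, and is the form used for the moments. -/
theorem Matrix.exists_isStarProjection_forall_norm_sub_mul_le (A : Matrix m n ℝ) (k : ℕ) :
    ∃ Q : Matrix n n ℝ, IsStarProjection Q ∧ ‖Q‖ ^ 2 ≤ k ∧
      ∀ Q' : Matrix n n ℝ, IsStarProjection Q' → ‖Q'‖ ^ 2 ≤ k → ‖A - A * Q‖ ≤ ‖A - A * Q'‖ := by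
  have : ProperSpace (Matrix n n ℝ) := FiniteDimensional.proper_real _
  have hK : IsCompact {Q : Matrix n n ℝ | (Q * Q = Q ∧ star Q = Q) ∧ ‖Q‖ ^ 2 ≤ k} := by
    refine Metric.isCompact_of_isClosed_isBounded ?_ ?_
    · have h1 : IsClosed {Q : Matrix n n ℝ | Q * Q = Q} := isClosed_eq (by fun_prop) (by fun_prop)
      have h2 : IsClosed {Q : Matrix n n ℝ | star Q = Q} := isClosed_eq (by fun_prop) (by fun_prop)
      have h3 : IsClosed {Q : Matrix n n ℝ | ‖Q‖ ^ 2 ≤ k} := isClosed_le (by fun_prop) (by fun_prop)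
      exact (h1.inter h2).inter h3
    · refine (Metric.isBounded_closedBall (x := 0) (r := √k)).subset fun Q hQ => ?_
      rw [mem_closedBall_zero_iff]
      exact Real.le_sqrt_of_sq_le hQ.2
  obtain ⟨Q, hQ, hmin⟩ := hK.exists_isMinOn ⟨0, by simp⟩
    (f := fun Q => ‖A - A * Q‖) (by fun_prop)
  exact ⟨Q, ⟨hQ.1.1, hQ.1.2⟩, hQ.2, fun Q' h h' =>
    hmin ⟨⟨h.isIdempotentElem.eq, h.isSelfAdjoint.star_eq⟩, h'⟩⟩

/-- A minimizer over the projections acting on the right also bounds the cost of every projection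
acting on the left. -/
theorem Matrix.exists_isStarProjection_forall_norm_sub_mul_le_left [DecidableEq m]
    (A : Matrix m n ℝ) (k : ℕ) :
    ∃ Q : Matrix n n ℝ, IsStarProjection Q ∧ ‖Q‖ ^ 2 ≤ k ∧
      ∀ P : Matrix m m ℝ, P.rank = k → ‖A - A * Q‖ ≤ ‖A - P * A‖ := by
  obtain ⟨Q, hQ, hk, hmin⟩ := A.exists_isStarProjection_forall_norm_sub_mul_le k
  refine ⟨Q, hQ, hk, fun P hPk => ?_⟩
  -- The competitor is the projection onto the row space of `P * A`; its residual is `A - P * A`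
  -- times `1 - Q'`, hence no larger.
  obtain ⟨Q', hQ', hPQ, hle⟩ := (P * A).exists_isStarProjection_mul_eq_self
  have hr : ((P * A).rank : ℝ) ≤ k := by
    rw [← hPk]
    exact_mod_cast Matrix.rank_mul_le_left P A
  refine (hmin Q' hQ' (hle.trans hr)).trans ?_
  have e : A - A * Q' = (A - P * A) * (1 - Q') := by
    rw [Matrix.sub_mul, Matrix.mul_sub, Matrix.mul_sub, hPQ]
    simp
  rw [e]
  exact hQ'.one_sub.frobenius_norm_mul_le' _

theorem Matrix.frobenius_norm_mul_sq_sub {q : Type*} [Fintype q] (B : Matrix m n ℝ)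
    (S : Matrix n q ℝ) :
    ‖B * S‖ ^ 2 - ‖B‖ ^ 2 = (B * (S * Sᵀ - 1) * Bᵀ).trace := by
  rw [Matrix.frobenius_norm_sq_eq_trace, Matrix.frobenius_norm_sq_eq_trace, ← Matrix.trace_sub]
  congr 1
  simp only [Matrix.transpose_mul, Matrix.mul_sub, Matrix.sub_mul, Matrix.mul_one,
    Matrix.mul_assoc]

/-- The factor after `‖A - P * A‖ ^ 2` depends on `P` only through the bound `κ`. The full trace of
`R * G * Rᵀ` is kept apart from its compression by `P`, so Cauchy–Schwarz costs `‖P‖` rather than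
`‖1 - P‖`, which would grow with the dimension. -/
theorem Matrix.abs_trace_mul_mul_transpose_le [DecidableEq m] {A R : Matrix m n ℝ}
    {P : Matrix m m ℝ} {Q G : Matrix n n ℝ}
    (hP : IsStarProjection P) (hQ : IsStarProjection Q) (hG : Gᵀ = G) {r κ : ℝ} (hr : 0 ≤ r)
    (hR : A - A * Q = r • R) (hrB : r ≤ ‖A - P * A‖) (hPκ : ‖P‖ ≤ κ) :
    |((A - P * A) * G * (A - P * A)ᵀ).trace| ≤ ‖A - P * A‖ ^ 2 *
      (‖Q * G * Qᵀ‖ + 2 * ‖Q * G * Rᵀ‖ + |(R * G * Rᵀ).trace| + κ * ‖R * G * Rᵀ‖) := by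
  set B := A - P * A with hB
  have hQt := hQ.transpose_eq
  have hPt := hP.transpose_eq
  have hPB : (1 - P) * B = B := by
    have hPP : P * (P * A) = P * A := by rw [← Matrix.mul_assoc, hP.isIdempotentElem.eq]
    rw [hB, Matrix.sub_mul 1 P, Matrix.mul_sub P, hPP]
    simp
  have hBQ : B - B * Q = r • ((1 - P) * R) := by
    rw [← Matrix.mul_smul, ← hR, hB]
    simp only [Matrix.sub_mul, Matrix.mul_sub, Matrix.one_mul, Matrix.mul_assoc]
  have hBdec : B = B * Q + r • ((1 - P) * R) := by rw [← hBQ]; abel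
  have hdec : (B * G * Bᵀ).trace = (B * (Q * G * Qᵀ) * Bᵀ).trace +
      2 * r * (B * (Q * G * Rᵀ)).trace +
      r ^ 2 * ((R * G * Rᵀ).trace - (P * (R * G * Rᵀ)).trace) := by
    -- By cyclicity `1 - P` moves next to `B`, which absorbs it.
    have t1 : (B * Q * G * (r • ((1 - P) * R))ᵀ).trace = r * (B * (Q * G * Rᵀ)).trace := by
      rw [Matrix.transpose_smul, Matrix.transpose_mul, Matrix.transpose_sub, Matrix.transpose_one,
        hPt, Matrix.mul_smul, Matrix.trace_smul, smul_eq_mul, ← Matrix.mul_assoc,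
        Matrix.trace_mul_comm]
      congr 2
      rw [Matrix.mul_assoc, Matrix.mul_assoc, ← Matrix.mul_assoc (1 - P), hPB]
      simp only [Matrix.mul_assoc]
    have t2 : ((r • ((1 - P) * R)) * G * (B * Q)ᵀ).trace = r * (B * (Q * G * Rᵀ)).trace := by
      rw [← t1, ← Matrix.trace_transpose]
      simp only [Matrix.transpose_mul, Matrix.transpose_transpose, hG, Matrix.mul_assoc]
    have t3 : ((r • ((1 - P) * R)) * G * (r • ((1 - P) * R))ᵀ).trace =
        r ^ 2 * ((R * G * Rᵀ).trace - (P * (R * G * Rᵀ)).trace) := by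
      have hidem := hP.one_sub.isIdempotentElem.eq
      rw [Matrix.transpose_smul, Matrix.transpose_mul, hP.one_sub.transpose_eq, Matrix.mul_smul,
        Matrix.smul_mul, Matrix.smul_mul, smul_smul, Matrix.trace_smul, smul_eq_mul, sq,
        ← Matrix.mul_assoc, Matrix.trace_mul_comm, Matrix.mul_assoc (1 - P) R G,
        Matrix.mul_assoc (1 - P) (R * G), ← Matrix.mul_assoc (1 - P) (1 - P), hidem,
        Matrix.sub_mul, Matrix.one_mul, Matrix.trace_sub]
    have e : B * G * Bᵀ = B * (Q * G * Qᵀ) * Bᵀ + B * Q * G * (r • ((1 - P) * R))ᵀ +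
        (r • ((1 - P) * R)) * G * (B * Q)ᵀ +
        (r • ((1 - P) * R)) * G * (r • ((1 - P) * R))ᵀ := by
      conv_lhs => rw [hBdec]
      simp only [Matrix.transpose_add, Matrix.mul_add, Matrix.add_mul, Matrix.transpose_mul,
        Matrix.mul_assoc]
      abel
    rw [e, Matrix.trace_add, Matrix.trace_add, Matrix.trace_add, t1, t2, t3]
    ring
  have b1 : |(B * (Q * G * Qᵀ) * Bᵀ).trace| ≤ ‖B‖ ^ 2 * ‖Q * G * Qᵀ‖ := by
    refine (Matrix.abs_trace_mul_le _ _).trans ?_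
    rw [Matrix.frobenius_norm_transpose]
    calc _ ≤ ‖B‖ * ‖Q * G * Qᵀ‖ * ‖B‖ := by
          gcongr
          exact Matrix.frobenius_norm_mul _ _
      _ = _ := by ring
  have b2 : |(B * (Q * G * Rᵀ)).trace| ≤ ‖B‖ * ‖Q * G * Rᵀ‖ := Matrix.abs_trace_mul_le _ _
  have b3 : |(P * (R * G * Rᵀ)).trace| ≤ κ * ‖R * G * Rᵀ‖ :=
    (Matrix.abs_trace_mul_le _ _).trans (by gcongr)
  rw [hdec]
  have hrB2 : r ^ 2 ≤ ‖B‖ ^ 2 := by gcongr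
  calc _ ≤ |(B * (Q * G * Qᵀ) * Bᵀ).trace| + 2 * r * |(B * (Q * G * Rᵀ)).trace| +
        r ^ 2 * (|(R * G * Rᵀ).trace| + |(P * (R * G * Rᵀ)).trace|) := by
        refine (abs_add_le _ _).trans (add_le_add ((abs_add_le _ _).trans (le_of_eq ?_)) ?_)
        · rw [abs_mul, abs_of_nonneg (by positivity : 0 ≤ 2 * r)]
        · rw [abs_mul, abs_of_nonneg (by positivity : 0 ≤ r ^ 2)]
          gcongr
          exact abs_sub _ _
    _ ≤ ‖B‖ ^ 2 * ‖Q * G * Qᵀ‖ + 2 * ‖B‖ * (‖B‖ * ‖Q * G * Rᵀ‖) +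
        ‖B‖ ^ 2 * (|(R * G * Rᵀ).trace| + κ * ‖R * G * Rᵀ‖) := by gcongr
    _ = _ := by ring

end Projection

/-! ### Choice of constants and conclusion by Markov's inequality. -/

theorem eight_mul_quadratic_le_exp_mul_nine_pow (k : ℕ) :
    8 * ((k : ℝ) ^ 2 + 5 * k + 1) ≤ 1152 * Real.exp 1 * 9 ^ k := by
  have h3 : (1 + (k : ℝ) * 2) ≤ 3 ^ k := by
    have := one_add_mul_le_pow (a := (2 : ℝ)) (by norm_num) k
    norm_num at this
    exact this
  have h9 : (1 + (k : ℝ) * 2) ^ 2 ≤ 9 ^ k := by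
    calc (1 + (k : ℝ) * 2) ^ 2 ≤ (3 ^ k) ^ 2 := by gcongr
      _ = 9 ^ k := by rw [← pow_mul, mul_comm, pow_mul]; norm_num
  have he : (1 : ℝ) ≤ Real.exp 1 := Real.one_le_exp (by norm_num)
  calc 8 * ((k : ℝ) ^ 2 + 5 * k + 1) ≤ 1152 * 1 * (1 + (k : ℝ) * 2) ^ 2 := by
        nlinarith [sq_nonneg (k : ℝ), Nat.cast_nonneg (α := ℝ) k]
    _ ≤ _ := by gcongr

theorem mainTheorem9 {Ω : Type*} [MeasurableSpace Ω] (μ : Measure Ω) [IsProbabilityMeasure μ]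
    (n k q : ℕ) (A : Matrix (Fin n) (Fin n) ℝ) (S : Ω → Matrix (Fin n) (Fin q) ℝ)
    (hS : IsScaledGaussianMatrix μ S)
    (ε δ : ℝ) (hε : 0 < ε) (hε1 : ε < 1) (hδ : 0 < δ)
    (hq : 1152 * Real.exp 1 * (9 ^ k / (ε ^ 2 * δ)) ≤ (q : ℝ)) :
    1 - δ ≤ μ.real {ω | IsPCPS ε 0 k A (A * S ω)} := by
  have hqR : (0 : ℝ) < q := lt_of_lt_of_le (by positivity) hq
  have hq0 : 0 < q := by exact_mod_cast hqR
  obtain ⟨Q, hQ, hQk, hmin⟩ := A.exists_isStarProjection_forall_norm_sub_mul_le_left k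
  set r : ℝ := ‖A - A * Q‖ with hr
  -- If `r = 0` then `R = 0`, so only `‖R‖ ≤ 1` is available.
  set R : Matrix (Fin n) (Fin n) ℝ := r⁻¹ • (A - A * Q) with hR
  have hAR : A - A * Q = r • R := by
    rcases eq_or_ne r 0 with h0 | h0
    · rw [h0, zero_smul]
      exact norm_eq_zero.1 (hr ▸ h0)
    · rw [hR, smul_smul, mul_inv_cancel₀ h0, one_smul]
  have hR1 : ‖R‖ ≤ 1 := by
    rw [hR, norm_smul, norm_inv, Real.norm_of_nonneg (norm_nonneg _)]
    exact inv_mul_le_one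
  set G : Ω → Matrix (Fin n) (Fin n) ℝ := fun ω => S ω * (S ω)ᵀ - 1 with hG
  -- `W` dominates the square of the deterministic factor with `κ = √k`: the outer 4 is
  -- Cauchy–Schwarz for four terms, the inner 4 and `k` are the squares of the coefficients 2 and
  -- `√k`.
  set W : Ω → ℝ := fun ω => 4 * (‖Q * G ω * Qᵀ‖ ^ 2 + 4 * ‖Q * G ω * Rᵀ‖ ^ 2 +
    (R * G ω * Rᵀ).trace ^ 2 + k * ‖R * G ω * Rᵀ‖ ^ 2) with hW
  have i1 := hS.integrable_norm_mul_mul_sq hq0 Q Q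
  have i2 := (hS.integrable_norm_mul_mul_sq hq0 Q R).const_mul 4
  have i3 := hS.integrable_trace_sq hq0 R
  have i4 := (hS.integrable_norm_mul_mul_sq hq0 R R).const_mul k
  have hWi : Integrable W μ := (((i1.add i2).add i3).add i4).const_mul 4
  have hWint : ∫ ω, W ω ∂μ ≤ 8 * ((k : ℝ) ^ 2 + 5 * k + 1) / q := by
    have e : ∫ ω, W ω ∂μ = 4 * (∫ ω, ‖Q * G ω * Qᵀ‖ ^ 2 ∂μ + 4 * ∫ ω, ‖Q * G ω * Rᵀ‖ ^ 2 ∂μ +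
        ∫ ω, (R * G ω * Rᵀ).trace ^ 2 ∂μ + k * ∫ ω, ‖R * G ω * Rᵀ‖ ^ 2 ∂μ) := by
      rw [integral_const_mul, integral_add, integral_add, integral_add, integral_const_mul,
        integral_const_mul]
      exacts [i1, i2, i1.add i2, i3, (i1.add i2).add i3, i4]
    have b1 : ∫ ω, ‖Q * G ω * Qᵀ‖ ^ 2 ∂μ ≤ 2 / q * (k * k) :=
      (hS.integral_norm_mul_mul_sq_le hq0 Q Q).trans (by gcongr)
    have hR2 : ‖R‖ ^ 2 ≤ 1 := pow_le_one₀ (norm_nonneg _) hR1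
    have b2 : ∫ ω, ‖Q * G ω * Rᵀ‖ ^ 2 ∂μ ≤ 2 / q * (k * 1) :=
      (hS.integral_norm_mul_mul_sq_le hq0 Q R).trans (by gcongr)
    have b3 : ∫ ω, (R * G ω * Rᵀ).trace ^ 2 ∂μ ≤ 2 / q * 1 :=
      (hS.integral_trace_sq_le hq0 R).trans (by
        gcongr
        exact pow_le_one₀ (norm_nonneg _) hR1)
    have b4 : ∫ ω, ‖R * G ω * Rᵀ‖ ^ 2 ∂μ ≤ 2 / q * (1 * 1) :=
      (hS.integral_norm_mul_mul_sq_le hq0 R R).trans (by gcongr)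
    rw [e]
    calc _ ≤ 4 * (2 / q * (k * k) + 4 * (2 / q * (k * 1)) + 2 / q * 1 +
          (k : ℝ) * (2 / q * (1 * 1))) := by gcongr
      _ = _ := by ring
  have hbad : μ.real {ω | ε ^ 2 ≤ W ω} ≤ δ := by
    have hmarkov := mul_meas_ge_le_integral_of_nonneg
      (Filter.Eventually.of_forall fun ω => by simp only [hW, Pi.zero_apply]; positivity)
      hWi (ε ^ 2)
    have hsmall : 8 * ((k : ℝ) ^ 2 + 5 * k + 1) / q ≤ ε ^ 2 * δ := by
      rw [div_le_iff₀ hqR]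
      refine (eight_mul_quadratic_le_exp_mul_nine_pow k).trans ?_
      have := mul_le_mul_of_nonneg_left hq (by positivity : 0 ≤ ε ^ 2 * δ)
      refine le_trans (le_of_eq ?_) this
      field_simp
    exact le_of_mul_le_mul_left ((hmarkov.trans hWint).trans hsmall) (by positivity)
  have hgood : ∀ ω, W ω < ε ^ 2 → IsPCPS ε 0 k A (A * S ω) := by
    intro ω hω
    refine ⟨hε.le, hε1, le_rfl, fun P hP hPk => ?_⟩
    have hGt : (G ω)ᵀ = G ω := by
      simp [hG, Matrix.transpose_sub, Matrix.transpose_mul]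
    have hPκ : ‖P‖ ≤ √k := by
      refine Real.le_sqrt_of_sq_le ?_
      rw [← hPk]
      exact hP.frobenius_norm_sq_le_rank
    have hdet := Matrix.abs_trace_mul_mul_transpose_le hP hQ hGt (norm_nonneg _) hAR
      (hmin P hPk) hPκ
    have hsum : ‖Q * G ω * Qᵀ‖ + 2 * ‖Q * G ω * Rᵀ‖ + |(R * G ω * Rᵀ).trace| +
        √k * ‖R * G ω * Rᵀ‖ ≤ ε := by
      refine le_of_sq_le_sq (le_trans ?_ hω.le) hε.le
      have hk : √(k : ℝ) ^ 2 = k := Real.sq_sqrt (by positivity)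
      simp only [hW]
      rw [← sq_abs (R * G ω * Rᵀ).trace]
      nth_rewrite 2 [← hk]
      rw [← mul_pow]
      generalize ‖Q * G ω * Qᵀ‖ = a
      generalize ‖Q * G ω * Rᵀ‖ = b
      generalize |(R * G ω * Rᵀ).trace| = c
      generalize √(k : ℝ) * ‖R * G ω * Rᵀ‖ = d
      nlinarith [sq_nonneg (a - 2 * b), sq_nonneg (a - c), sq_nonneg (a - d),
        sq_nonneg (2 * b - c), sq_nonneg (2 * b - d), sq_nonneg (c - d)]
    have hBS : A * S ω - P * (A * S ω) = (A - P * A) * S ω := by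
      rw [Matrix.sub_mul, Matrix.mul_assoc]
    rw [hBS, add_zero]
    have hfin := abs_le.1 (hdet.trans (mul_le_mul_of_nonneg_left hsum (sq_nonneg _)))
    rw [← Matrix.frobenius_norm_mul_sq_sub] at hfin
    constructor <;> linarith [hfin.1, hfin.2]
  have hcover : (Set.univ : Set Ω) ⊆
      {ω | IsPCPS ε 0 k A (A * S ω)} ∪ {ω | ε ^ 2 ≤ W ω} := fun ω _ => by
    rcases lt_or_ge (W ω) (ε ^ 2) with h | h
    · exact Or.inl (hgood ω h)
    · exact Or.inr h
  have hone : μ.real (Set.univ : Set Ω) ≤ _ :=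
    (measureReal_mono hcover).trans (measureReal_union_le _ _)
  rw [probReal_univ] at hone
  linarith
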